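/- For positive integers $s_1,\dots,s_k$ with $s_1>1$ let $$\zeta(s_1,\dots,s_k)=\sum_{n_1>n_2>\cdots>n_k>0}\ \prod_{j=1}^k n_j^{-s_j}$$ be the multiple zeta value (a convergent series; the value at the empty string is $1$). For an integer $n\ge 0$ and non-negative integers $m_0,\dots,m_{2n}$ put $$Z(m_0,\dots,m_{2n})=\zeta(\{2\}^{m_0},3,\{2\}^{m_1},1,\{2\}^{m_2},3,\{2\}^{m_3},1,\dots,3,\{2\}^{m_{2n-1}},1,\{2\}^{m_{2n}}),$$ where $\{2\}^{r}$ denotes $r$ consecutive arguments equal to $2$; that is, $m_j$ twos are inserted after the $j$-th element of the string $\{3,1\}^n$ for $j=0,\dots,2n$. In particular $Z(m)=\zeta(\{2\}^m)$. Let $$\mathscr C(m_0,\dots,m_{2n})=\sum_{j=0}^{2n}Z(m_j,m_{j+1},\dots,m_{2n},m_0,\dots,m_{j-1}),$$ and let $C_r(k)$ denote the set of ordered $r$-tuples of non-negative integers with sum $k$. **Theorem.** For all integers $m\ge 2n\ge 0$, the series defining the multiple zeta values below converge and $$\sum_{\vec s\in C_{2n+1}(m-2n)}\mathscr C(\vec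 s)=Z(m)\,|C_{2n+1}(m-2n)|=Z(m)\binom{m}{2n}=\frac{\pi^{2m}}{(2m+1)!}\binom{m}{2n}.$$ -/

import Mathlib

noncomputable section

namespace MZV

/-- The index set `n₁ > n₂ > ⋯ > n_k > 0` of the nested sum of depth `k`. -/
abbrev Idx (k : ℕ) : Type := {t : Fin k → ℕ // StrictAnti t ∧ ∀ j, 0 < t j}

/-- The summand `∏ⱼ nⱼ ^ (-sⱼ)` of the nested sum with argument string `s`. -/
def term (s : List ℕ) (t : Idx s.length) : ℝ :=
  ∏ j : Fin s.length, ((t.1 j : ℝ) ^ s.get j)⁻¹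

/-- The multiple zeta value
`ζ(s₁, …, s_k) = ∑_{n₁ > ⋯ > n_k > 0} ∏ⱼ nⱼ ^ (-sⱼ)`; the value at the empty string is `1`. -/
def zeta (s : List ℕ) : ℝ := ∑' t : Idx s.length, term s t

/-- The argument string
`{2}^{m₀}, 3, {2}^{m₁}, 1, {2}^{m₂}, 3, {2}^{m₃}, 1, …, 3, {2}^{m_{2n-1}}, 1, {2}^{m_{2n}}`,
that is, `{3,1}^n` with `mⱼ` twos inserted after its `j`-th element. -/
def args {n : ℕ} (s : Fin (2 * n + 1) → ℕ) : List ℕ :=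
  List.replicate (s 0) 2 ++
    (List.finRange n).flatMap fun (k : Fin n) =>
      3 :: (List.replicate (s ⟨2 * k + 1, by have := k.isLt; omega⟩) 2 ++
        1 :: List.replicate (s ⟨2 * k + 2, by have := k.isLt; omega⟩) 2)

/-- `Z(m₀, …, m_{2n})`. -/
def Z {n : ℕ} (s : Fin (2 * n + 1) → ℕ) : ℝ := zeta (args s)

/-- The one-part string `(m)`, so that `Z (single m) = ζ({2}^m)`. -/
def single (m : ℕ) : Fin (2 * 0 + 1) → ℕ := fun _ => m

/-- The cyclic sum `∑_{j=0}^{2n} Z(mⱼ, m_{j+1}, …, m_{2n}, m₀, …, m_{j-1})`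
(the addition of indices in `Fin (2 * n + 1)` is modulo `2 * n + 1`). -/
def cyclicSum {n : ℕ} (s : Fin (2 * n + 1) → ℕ) : ℝ :=
  ∑ j : Fin (2 * n + 1), Z fun i => s (i + j)

/-- The set `C_r(k)` of ordered compositions of `k` into `r` non-negative integer parts. -/
def compositions (r k : ℕ) : Finset (Fin r → ℕ) := Finset.Nat.antidiagonalTuple r k

theorem mem_compositions {r k : ℕ} {s : Fin r → ℕ} :
    s ∈ compositions r k ↔ ∑ i, s i = k :=
  Finset.Nat.mem_antidiagonalTuple

end MZV

end

noncomputable section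

namespace MZV

open PowerSeries

/-! This is a shuffle-product proof. Strings of arguments are words in a = `dx / x` and b = `dx / (1
- x)`; multiple polylogarithms are the iterated integrals, kept here as formal power series in x.
Let A_p be the series of the words (ab)^i in which each letter carries p and each b a further
variable u. If p² + q² = 1 and w = 2pq, the shuffle product A_p A_q solves a linear system in which
blocks ab and ba have weight 1 and blocks aa and bb have weight w. Its solution is the sum over n of
w^(2n) times all words for {3,1}^n with inserted twos (`coeff_twoSeries_mul_twoSeries`).

At x = 1 this expresses ∑ p^(2i) q^(2j) Z(i) Z(j), i + j = m, through the sums wanted. Since Z(i) =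
π^(2i) / (2i+1)! by Euler's sine product (`Z_single`), w times the left side is π^(2m) / (2m+2)! ·
((q+p)^(2m+2) - (q-p)^(2m+2)), and (q ± p)² = 1 ± w makes it a polynomial in w. Comparing
coefficients gives `sumZ_eq`. Rotations permute the compositions, so cyclic summation only
multiplies by 2n + 1. -/

/-! ### Formal iterated integration and its product rules -/

/-- Integration against `dx / x`, for power series without constant term. -/
def intA : ℝ⟦X⟧ →ₗ[ℝ] ℝ⟦X⟧ where
  toFun f := PowerSeries.mk fun n => coeff n f / n
  map_add' f g := by ext n; simp [add_div]
  map_smul' r f := by ext n; simp [mul_div_assoc]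

/-- Integration against `dx / (1 - x)`. -/
def intB : ℝ⟦X⟧ →ₗ[ℝ] ℝ⟦X⟧ where
  toFun f := PowerSeries.mk fun n => (∑ k ∈ Finset.range n, coeff k f) / n
  map_add' f g := by ext n; simp [Finset.sum_add_distrib, add_div]
  map_smul' r f := by ext n; simp [← Finset.mul_sum, mul_div_assoc]

theorem coeff_intA (f : ℝ⟦X⟧) (n : ℕ) : coeff n (intA f) = coeff n f / n := by
  simp [intA]

theorem coeff_intB (f : ℝ⟦X⟧) (n : ℕ) :
    coeff n (intB f) = (∑ k ∈ Finset.range n, coeff k f) / n := by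
  simp [intB]

/-- The convention `x / 0 = 0` discards the constant term. -/
theorem constantCoeff_intA (f : ℝ⟦X⟧) : constantCoeff (intA f) = 0 := by
  rw [← coeff_zero_eq_constantCoeff_apply, coeff_intA]; simp

theorem constantCoeff_intB (f : ℝ⟦X⟧) : constantCoeff (intB f) = 0 := by
  rw [← coeff_zero_eq_constantCoeff_apply, coeff_intB]; simp

theorem X_mul_derivative_intA {f : ℝ⟦X⟧} (hf : constantCoeff f = 0) :
    X * derivative ℝ (intA f) = f := by
  ext n
  cases n with
  | zero => simp [hf]
  | succ n =>
    rw [coeff_succ_X_mul, coeff_derivative, coeff_intA]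
    push_cast
    field_simp

theorem one_sub_X_mul_derivative_intB (f : ℝ⟦X⟧) :
    (1 - X) * derivative ℝ (intB f) = f := by
  have h : ∀ n, coeff n (derivative ℝ (intB f)) = ∑ k ∈ Finset.range (n + 1), coeff k f := by
    intro n
    rw [coeff_derivative, coeff_intB]
    push_cast
    field_simp
  ext n
  rw [sub_mul, one_mul, map_sub]
  cases n with
  | zero => rw [h]; simp
  | succ n => rw [coeff_succ_X_mul, h, h, Finset.sum_range_succ]; ring

theorem one_sub_X_ne_zero : (1 - X : ℝ⟦X⟧) ≠ 0 := by
  intro h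
  have := congrArg constantCoeff h
  simp at this

theorem eq_of_X_mul_one_sub_X_mul_derivative {f g : ℝ⟦X⟧}
    (h : X * ((1 - X) * derivative ℝ f) = X * ((1 - X) * derivative ℝ g))
    (h0 : constantCoeff f = constantCoeff g) : f = g :=
  derivative.ext (mul_left_cancel₀ one_sub_X_ne_zero (mul_left_cancel₀ X_ne_zero h)) h0

/-- Integration by parts: the outermost letter of a shuffle comes from one factor or the other. The
next two rules are the same for the other pairs of letters. -/
theorem intA_mul_intA {f g : ℝ⟦X⟧} (hf : constantCoeff f = 0) (hg : constantCoeff g = 0) :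
    intA f * intA g = intA (f * intA g) + intA (intA f * g) := by
  apply eq_of_X_mul_one_sub_X_mul_derivative
  · have h1 := X_mul_derivative_intA hf
    have h2 := X_mul_derivative_intA hg
    have h3 := X_mul_derivative_intA (f := f * intA g) (by simp [hf])
    have h4 := X_mul_derivative_intA (f := intA f * g) (by simp [hg])
    simp only [Derivation.leibniz, map_add, smul_eq_mul]
    linear_combination (1 - X) * (intA f * h2 + intA g * h1 - h3 - h4)
  · simp [constantCoeff_intA]

theorem intB_mul_intA (f : ℝ⟦X⟧) {g : ℝ⟦X⟧} (hg : constantCoeff g = 0) :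
    intB f * intA g = intB (f * intA g) + intA (intB f * g) := by
  apply eq_of_X_mul_one_sub_X_mul_derivative
  · have h1 := one_sub_X_mul_derivative_intB f
    have h2 := X_mul_derivative_intA hg
    have h3 := one_sub_X_mul_derivative_intB (f * intA g)
    have h4 := X_mul_derivative_intA (f := intB f * g) (by simp [hg])
    simp only [Derivation.leibniz, map_add, smul_eq_mul]
    linear_combination (1 - X) * (intB f * h2 - h4) + X * (intA g * h1 - h3)
  · simp [constantCoeff_intA, constantCoeff_intB]

theorem intB_mul_intB (f g : ℝ⟦X⟧) :
    intB f * intB g = intB (f * intB g) + intB (intB f * g) := by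
  apply eq_of_X_mul_one_sub_X_mul_derivative
  · have h1 := one_sub_X_mul_derivative_intB f
    have h2 := one_sub_X_mul_derivative_intB g
    have h3 := one_sub_X_mul_derivative_intB (f * intB g)
    have h4 := one_sub_X_mul_derivative_intB (intB f * g)
    simp only [Derivation.leibniz, map_add, smul_eq_mul]
    linear_combination X * (intB f * h2 + intB g * h1 - h3 - h4)
  · simp [constantCoeff_intB]

/-! ### Shuffling two generating series of twos -/

theorem coeff_real_smul (r : ℝ) (F : ℝ⟦X⟧⟦X⟧) (m : ℕ) : coeff m (r • F) = r • coeff m F := rfl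

/-- The coefficientwise action of a linear operator on power series in a second variable. -/
def lift (T : ℝ⟦X⟧ →ₗ[ℝ] ℝ⟦X⟧) : ℝ⟦X⟧⟦X⟧ →ₗ[ℝ] ℝ⟦X⟧⟦X⟧ where
  toFun F := PowerSeries.mk fun m => T (coeff m F)
  map_add' F G := by ext1 m; simp
  map_smul' r F := by
    refine PowerSeries.ext fun m => ?_
    simp only [coeff_mk, RingHom.id_apply, coeff_real_smul, map_smul]

theorem coeff_lift (T : ℝ⟦X⟧ →ₗ[ℝ] ℝ⟦X⟧) (F : ℝ⟦X⟧⟦X⟧) (m : ℕ) :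
    coeff m (lift T F) = T (coeff m F) := by
  simp [lift]

theorem lift_X_mul (T : ℝ⟦X⟧ →ₗ[ℝ] ℝ⟦X⟧) (F : ℝ⟦X⟧⟦X⟧) :
    lift T (X * F) = X * lift T F := by
  refine PowerSeries.ext fun m => ?_
  cases m <;> simp [coeff_lift, coeff_succ_X_mul]

theorem lift_mul_lift (S T : ℝ⟦X⟧ →ₗ[ℝ] ℝ⟦X⟧) (F G : ℝ⟦X⟧⟦X⟧)
    (h : ∀ i j, S (coeff i F) * T (coeff j G) =
      S (coeff i F * T (coeff j G)) + T (S (coeff i F) * coeff j G)) :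
    lift S F * lift T G = lift S (F * lift T G) + lift T (lift S F * G) := by
  refine PowerSeries.ext fun m => ?_
  simp only [map_add, coeff_lift, coeff_mul, map_sum, h, Finset.sum_add_distrib]

/-- `∑ᵢ p ^ (2 i) uⁱ Li_{{2}^i}(x)`. -/
def twoSeries (p : ℝ) : ℝ⟦X⟧⟦X⟧ :=
  PowerSeries.mk fun i => (p ^ 2) ^ i • ((intA ∘ₗ intB) ^ i) 1

/-- The companion of `twoSeries` with the outermost `dx / x` removed. -/
def oneTwoSeries (p : ℝ) : ℝ⟦X⟧⟦X⟧ := p • (X * lift intB (twoSeries p))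

theorem twoSeries_eq (p : ℝ) : twoSeries p = 1 + p • lift intA (oneTwoSeries p) := by
  rw [oneTwoSeries, map_smul, lift_X_mul]
  refine PowerSeries.ext fun m => ?_
  cases m with
  | zero => simp [twoSeries]
  | succ m =>
    simp only [map_add, coeff_real_smul, coeff_succ_X_mul, coeff_lift, twoSeries, coeff_mk, map_smul, pow_succ',
      Module.End.mul_apply, LinearMap.comp_apply, smul_smul]
    simp [coeff_one]

theorem constantCoeff_coeff_oneTwoSeries (p : ℝ) (m : ℕ) :
    constantCoeff (coeff m (oneTwoSeries p)) = 0 := by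
  have hs' : ∀ (r : ℝ) (F : ℝ⟦X⟧), constantCoeff (r • F) = r • constantCoeff F :=
    fun r F => by simp
  cases m with
  | zero => simp [oneTwoSeries]
  | succ m =>
    rw [oneTwoSeries, coeff_real_smul, hs', coeff_succ_X_mul, coeff_lift, constantCoeff_intB, smul_zero]

theorem oneTwoSeries_mul_twoSeries (p q : ℝ) :
    oneTwoSeries p * twoSeries q = p • (X * lift intB (twoSeries p * twoSeries q)) +
      q • lift intA (oneTwoSeries p * oneTwoSeries q) := by
  have h := lift_mul_lift intB intA (twoSeries p) (oneTwoSeries q)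
    fun i j => intB_mul_intA _ (constantCoeff_coeff_oneTwoSeries q j)
  have e1 (F : ℝ⟦X⟧⟦X⟧) : F * twoSeries q = F + q • (F * lift intA (oneTwoSeries q)) := by
    conv_lhs => rw [twoSeries_eq q, mul_add, mul_one, mul_smul_comm]
  have e2 (F : ℝ⟦X⟧⟦X⟧) : oneTwoSeries p * F = p • (X * (lift intB (twoSeries p) * F)) := by
    rw [oneTwoSeries, smul_mul_assoc, mul_assoc]
  rw [e1, e1, e2 (oneTwoSeries q), e2 (lift _ _), h, map_smul, lift_X_mul, map_add, map_smul]
  conv_lhs => rw [oneTwoSeries]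
  simp only [mul_add, smul_add, mul_smul_comm]
  module

/-- Two outer letters are stripped. The block ab arises with both letters from one factor, weight p²
+ q²; the block aa takes one letter from each factor, weight 2pq. -/
theorem twoSeries_mul_twoSeries {p q w : ℝ} (hpq : p ^ 2 + q ^ 2 = 1) (hw : w = 2 * p * q) :
    twoSeries p * twoSeries q =
      1 + X * lift intA (lift intB (twoSeries p * twoSeries q)) +
        w • lift intA (lift intA (oneTwoSeries p * oneTwoSeries q)) := by
  have h := lift_mul_lift intA intA (oneTwoSeries p) (oneTwoSeries q)
    fun i j => intA_mul_intA (constantCoeff_coeff_oneTwoSeries p i)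
      (constantCoeff_coeff_oneTwoSeries q j)
  have key : twoSeries p * twoSeries q = 1 + lift intA
      (p • (oneTwoSeries p * twoSeries q) + q • (oneTwoSeries q * twoSeries p)) := by
    rw [twoSeries_eq p, twoSeries_eq q]
    simp only [mul_add, add_mul, one_mul, mul_one, smul_mul_assoc, mul_smul_comm, map_add,
      map_smul, h, smul_add, mul_comm (oneTwoSeries q) (lift _ _), smul_comm q p]
    abel
  have e : p • (oneTwoSeries p * twoSeries q) + q • (oneTwoSeries q * twoSeries p) =
      X * lift intB (twoSeries p * twoSeries q) +
        w • lift intA (oneTwoSeries p * oneTwoSeries q) := by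
    rw [oneTwoSeries_mul_twoSeries p q, oneTwoSeries_mul_twoSeries q p, mul_comm (twoSeries q),
      mul_comm (oneTwoSeries q)]
    subst hw
    match_scalars
    · linear_combination hpq
    · ring1
  rw [e, map_add, map_smul, lift_X_mul] at key
  rw [add_assoc]
  exact key

theorem oneTwoSeries_mul_oneTwoSeries {p q w : ℝ} (hpq : p ^ 2 + q ^ 2 = 1)
    (hw : w = 2 * p * q) :
    oneTwoSeries p * oneTwoSeries q =
      X * lift intB (lift intA (oneTwoSeries p * oneTwoSeries q)) +
        w • (X * (X * lift intB (lift intB (twoSeries p * twoSeries q)))) := by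
  have h := lift_mul_lift intB intB (twoSeries p) (twoSeries q) fun i j => intB_mul_intB _ _
  have key : oneTwoSeries p * oneTwoSeries q = X * lift intB
      (p • (oneTwoSeries q * twoSeries p) + q • (oneTwoSeries p * twoSeries q)) := by
    have e : oneTwoSeries p * oneTwoSeries q =
        (p * q) • (X * (X * (lift intB (twoSeries p) * lift intB (twoSeries q)))) := by
      simp only [oneTwoSeries, smul_mul_assoc, mul_smul_comm, smul_smul,
        mul_assoc, mul_left_comm (lift intB (twoSeries p)) X, mul_comm q p]
    rw [e, h]
    simp only [oneTwoSeries, smul_mul_assoc, mul_smul_comm, map_add, map_smul, mul_add, smul_add,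
      smul_smul, mul_assoc, lift_X_mul, mul_comm q p, mul_comm (twoSeries p) (lift _ _)]
  have e : p • (oneTwoSeries q * twoSeries p) + q • (oneTwoSeries p * twoSeries q) =
      lift intA (oneTwoSeries p * oneTwoSeries q) +
        w • (X * lift intB (twoSeries p * twoSeries q)) := by
    rw [oneTwoSeries_mul_twoSeries p q, oneTwoSeries_mul_twoSeries q p, mul_comm (twoSeries q),
      mul_comm (oneTwoSeries q)]
    subst hw
    match_scalars
    · ring1
    · linear_combination hpq
  rw [e, map_add, map_smul, lift_X_mul, mul_add, mul_smul_comm] at key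
  exact key

/-! ### Multiple polylogarithms as words of integrations -/

/-- The multiple polylogarithm `∑ x ^ n₁ ∏ⱼ nⱼ ^ (-sⱼ)` as a power series. -/
def mpl : List ℕ → ℝ⟦X⟧
  | [] => 1
  | k :: s => PowerSeries.mk fun N => (∑ j ∈ Finset.range N, coeff j (mpl s)) / (N : ℝ) ^ k

theorem coeff_mpl_cons (k : ℕ) (s : List ℕ) (N : ℕ) :
    coeff N (mpl (k :: s)) = (∑ j ∈ Finset.range N, coeff j (mpl s)) / (N : ℝ) ^ k := by
  simp [mpl]

theorem mpl_one_cons (s : List ℕ) : mpl (1 :: s) = intB (mpl s) := by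
  ext N
  simp [coeff_mpl_cons, coeff_intB]

theorem mpl_succ_cons (k : ℕ) (s : List ℕ) :
    mpl ((k + 1) :: s) = intA (mpl (k :: s)) := by
  ext N
  rw [coeff_mpl_cons, coeff_intA, coeff_mpl_cons, pow_succ, div_div]

theorem mpl_two_cons (s : List ℕ) : mpl (2 :: s) = (intA ∘ₗ intB) (mpl s) := by
  rw [mpl_succ_cons 1, mpl_one_cons, LinearMap.comp_apply]

theorem mpl_replicate_append (i : ℕ) (s : List ℕ) :
    mpl (List.replicate i 2 ++ s) = ((intA ∘ₗ intB) ^ i) (mpl s) := by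
  induction i with
  | zero => simp
  | succ i ih =>
    rw [List.replicate_succ, List.cons_append, mpl_two_cons, ih, pow_succ', Module.End.mul_apply]

theorem mpl_replicate (i : ℕ) :
    mpl (List.replicate i 2) = ((intA ∘ₗ intB) ^ i) 1 := by
  rw [← List.append_nil (List.replicate i 2), mpl_replicate_append, mpl]

/-- Regrouping of the word: aab (ab)^i b = aa (ba)^i bb. -/
theorem mpl_three_replicate_one (i : ℕ) (s : List ℕ) :
    mpl (3 :: (List.replicate i 2 ++ 1 :: s)) =
      intA (intA (((intB ∘ₗ intA) ^ i) (intB (intB (mpl s))))) := by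
  have h : ∀ f, intB (((intA ∘ₗ intB) ^ i) f) = ((intB ∘ₗ intA) ^ i) (intB f) := by
    induction i with
    | zero => simp
    | succ i ih =>
      intro f
      rw [pow_succ, pow_succ, Module.End.mul_apply, Module.End.mul_apply, ih]
      rfl
  rw [mpl_succ_cons 2, mpl_two_cons, mpl_replicate_append, mpl_one_cons,
    LinearMap.comp_apply, h]

theorem args_succ {n : ℕ} (s : Fin (2 * (n + 1) + 1) → ℕ) :
    args s = List.replicate (s 0) 2 ++ 3 :: (List.replicate (s 1) 2 ++
      1 :: args fun i : Fin (2 * n + 1) => s ⟨i + 2, by omega⟩) := by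
  simp only [args, List.finRange_succ, List.flatMap_cons, List.flatMap_map]
  simp [Nat.mul_add, add_assoc]

/-! ### Sums over compositions and the linear system for their generating series -/

theorem sum_compositions_succ {M : Type*} [AddCommMonoid M] (r k : ℕ)
    (f : (Fin (r + 1) → ℕ) → M) :
    ∑ s ∈ compositions (r + 1) k, f s =
      ∑ x ∈ Finset.HasAntidiagonal.antidiagonal k, ∑ t ∈ compositions r x.2, f (Fin.cons x.1 t) := by
  rw [Finset.sum_sigma']
  refine Finset.sum_nbij' (fun s => ⟨(s 0, ∑ i, Fin.tail s i), Fin.tail s⟩)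
    (fun y => Fin.cons y.1.1 y.2) ?_ ?_ ?_ ?_ ?_
  · intro s hs
    rw [mem_compositions, Fin.sum_univ_succ] at hs
    simp [mem_compositions, Fin.tail, hs]
  · rintro ⟨⟨i, j⟩, t⟩ h
    simp only [Finset.mem_sigma, Finset.HasAntidiagonal.mem_antidiagonal, mem_compositions] at h
    simp [mem_compositions, Fin.sum_univ_succ, h]
  · intro s _
    simp
  · rintro ⟨⟨i, j⟩, t⟩ h
    simp only [Finset.mem_sigma, Finset.HasAntidiagonal.mem_antidiagonal, mem_compositions] at h
    simp [h.2]
  · intro s _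
    simp

/-- Splitting off the first part gives a hockey-stick sum. -/
theorem card_compositions (r k : ℕ) :
    (compositions (r + 1) k).card = (k + r).choose r := by
  induction r generalizing k with
  | zero => simp [compositions]
  | succ r ih =>
    rw [Finset.card_eq_sum_ones, sum_compositions_succ]
    simp only [← Finset.card_eq_sum_ones, ih]
    rw [Finset.Nat.sum_antidiagonal_eq_sum_range_succ_mk, ← Finset.sum_range_reflect]
    rw [← add_assoc, ← Nat.sum_range_add_choose k r]
    refine Finset.sum_congr rfl fun i hi => ?_
    have := Finset.mem_range.1 hi
    congr 2
    omega

/-- The sum of the polylogarithms of all strings `{3, 1} ^ n` with `k` twos inserted. -/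
def argsSum (n k : ℕ) : ℝ⟦X⟧ := ∑ s ∈ compositions (2 * n + 1) k, mpl (args s)

/-- The companion of `argsSum (n + 1)` for the words that remain after an initial
`dx / x · dx / x`. -/
def midSum (n k : ℕ) : ℝ⟦X⟧ :=
  ∑ x ∈ Finset.HasAntidiagonal.antidiagonal k, ((intB ∘ₗ intA) ^ x.1) (intB (intB (argsSum n x.2)))

theorem argsSum_zero (k : ℕ) : argsSum 0 k = ((intA ∘ₗ intB) ^ k) 1 := by
  have h : compositions (2 * 0 + 1) k = {fun _ => k} := by
    ext s
    simp only [mem_compositions, Finset.mem_singleton]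
    constructor
    · intro h
      funext i
      have : i = 0 := by omega
      subst this
      simpa using h
    · rintro rfl
      simp
  rw [argsSum, h, Finset.sum_singleton, ← mpl_replicate]
  simp [args]

theorem argsSum_succ (n k : ℕ) :
    argsSum (n + 1) k = ∑ x ∈ Finset.HasAntidiagonal.antidiagonal k,
      ((intA ∘ₗ intB) ^ x.1) (intA (intA (midSum n x.2))) := by
  rw [argsSum]
  change ∑ s ∈ compositions (2 * n + 1 + 1 + 1) k, mpl (args (n := n + 1) s) = _
  rw [sum_compositions_succ]
  refine Finset.sum_congr rfl fun x _ => ?_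
  rw [sum_compositions_succ, midSum]
  simp only [map_sum, argsSum]
  refine Finset.sum_congr rfl fun y _ => Finset.sum_congr rfl fun s _ => ?_
  rw [args_succ, mpl_replicate_append, mpl_three_replicate_one]
  rfl

/-- Coefficient form of the fact that F = ∑ uⁱ Tⁱ f solves F = f + u T F. -/
theorem sum_antidiagonal_pow_succ (T : ℝ⟦X⟧ →ₗ[ℝ] ℝ⟦X⟧) (f : ℕ → ℝ⟦X⟧) (k : ℕ) :
    ∑ x ∈ Finset.HasAntidiagonal.antidiagonal (k + 1), (T ^ x.1) (f x.2) =
      f (k + 1) + T (∑ x ∈ Finset.HasAntidiagonal.antidiagonal k, (T ^ x.1) (f x.2)) := by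
  rw [Finset.Nat.sum_antidiagonal_succ, map_sum]
  simp [pow_succ']

/-- The generating series of `argsSum n` by half the weight. -/
def argsSeries (n : ℕ) : ℝ⟦X⟧⟦X⟧ := X ^ (2 * n) * PowerSeries.mk (argsSum n)

/-- The generating series of `midSum n`. -/
def midSeries (n : ℕ) : ℝ⟦X⟧⟦X⟧ := X ^ (2 * n + 2) * PowerSeries.mk (midSum n)

theorem constantCoeff_lift (T : ℝ⟦X⟧ →ₗ[ℝ] ℝ⟦X⟧) (F : ℝ⟦X⟧⟦X⟧) :
    constantCoeff (lift T F) = T (constantCoeff F) := by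
  simp only [← coeff_zero_eq_constantCoeff_apply, coeff_lift]

theorem lift_X_pow_mul (T : ℝ⟦X⟧ →ₗ[ℝ] ℝ⟦X⟧) (F : ℝ⟦X⟧⟦X⟧) (r : ℕ) :
    lift T (X ^ r * F) = X ^ r * lift T F := by
  induction r with
  | zero => simp
  | succ r ih => rw [pow_succ', mul_assoc, lift_X_mul, ih, mul_assoc]

theorem argsSeries_zero : argsSeries 0 = 1 + X * lift intA (lift intB (argsSeries 0)) := by
  refine PowerSeries.ext fun m => ?_
  cases m with
  | zero => simp [argsSeries, argsSum_zero]
  | succ m =>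
    simp [argsSeries, argsSum_zero, coeff_lift, coeff_succ_X_mul, coeff_one, pow_succ']

theorem argsSeries_succ (n : ℕ) : argsSeries (n + 1) =
    X * lift intA (lift intB (argsSeries (n + 1))) + lift intA (lift intA (midSeries n)) := by
  rw [argsSeries, midSeries]
  simp only [lift_X_pow_mul]
  rw [mul_left_comm, Nat.mul_add, mul_one, ← mul_add]
  congr 1
  refine PowerSeries.ext fun m => ?_
  cases m with
  | zero => simp [constantCoeff_lift, argsSum_succ]
  | succ m =>
    simp only [map_add, coeff_succ_X_mul, coeff_lift, coeff_mk, argsSum_succ]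
    rw [sum_antidiagonal_pow_succ _ (fun k => intA (intA (midSum n k))), add_comm]
    rfl

theorem midSeries_eq (n : ℕ) : midSeries n =
    X * lift intB (lift intA (midSeries n)) +
      X * (X * lift intB (lift intB (argsSeries n))) := by
  rw [argsSeries, midSeries]
  simp only [lift_X_pow_mul]
  have e (F : ℝ⟦X⟧⟦X⟧) : X * (X * (X ^ (2 * n) * F)) = X ^ (2 * n + 2) * F := by ring
  rw [e, mul_left_comm, ← mul_add]
  congr 1
  refine PowerSeries.ext fun m => ?_
  cases m with
  | zero => simp [constantCoeff_lift, midSum]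
  | succ m =>
    simp only [map_add, coeff_succ_X_mul, coeff_lift, coeff_mk, midSum]
    rw [sum_antidiagonal_pow_succ _ (fun k => intB (intB (argsSum n k))), add_comm]
    rfl

/-- The shuffle product of two `ζ({2}^i)`-series in terms of the strings `{3, 1} ^ n` with inserted
twos. -/
theorem coeff_twoSeries_mul_twoSeries {p q w : ℝ} (hpq : p ^ 2 + q ^ 2 = 1)
    (hw : w = 2 * p * q) {m N : ℕ} (hm : m < 2 * (N + 1)) :
    coeff m (twoSeries p * twoSeries q) =
      ∑ n ∈ Finset.range (N + 1), w ^ (2 * n) • coeff m (argsSeries n) := by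
  set A := twoSeries p * twoSeries q with hA
  set B := oneTwoSeries p * oneTwoSeries q with hB
  set A' := ∑ n ∈ Finset.range (N + 1), w ^ (2 * n) • argsSeries n with hA'
  set B' := ∑ n ∈ Finset.range (N + 1), w ^ (2 * n + 1) • midSeries n with hB'
  have eA : A = 1 + X * lift intA (lift intB A) + w • lift intA (lift intA B) :=
    twoSeries_mul_twoSeries hpq hw
  have eB : B = X * lift intB (lift intA B) + w • (X * (X * lift intB (lift intB A))) :=
    oneTwoSeries_mul_oneTwoSeries hpq hw
  -- The truncated sums solve the same system as A and B up to one term, which is divisible by `X ^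
  -- (2 * N + 2)` and so does not affect the coefficients in question.
  have eA' : A' + w ^ (2 * N + 2) • lift intA (lift intA (midSeries N)) =
      1 + X * lift intA (lift intB A') + w • lift intA (lift intA B') := by
    have h1 : A' = 1 + X * lift intA (lift intB A') +
        ∑ n ∈ Finset.range N, w ^ (2 * n + 2) • lift intA (lift intA (midSeries n)) := by
      simp only [hA', map_sum, map_smul, Finset.mul_sum, mul_smul_comm]
      rw [Finset.sum_range_succ', Finset.sum_range_succ' (fun n => w ^ (2 * n) • (X * _))]
      rw [Finset.sum_congr rfl fun n _ => by rw [argsSeries_succ, smul_add],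
        Finset.sum_add_distrib, mul_zero, pow_zero, one_smul, one_smul]
      conv_lhs => rw [argsSeries_zero]
      simp only [Nat.mul_add]
      abel
    conv_lhs => rw [h1]
    simp only [hB', map_sum, map_smul, Finset.smul_sum, smul_smul, ← pow_succ']
    rw [Finset.sum_range_succ _ N, add_assoc]
  have eB' : B' = X * lift intB (lift intA B') + w • (X * (X * lift intB (lift intB A'))) := by
    simp only [hB', hA', map_sum, map_smul, Finset.mul_sum, mul_smul_comm, Finset.smul_sum,
      smul_smul, ← pow_succ']
    rw [← Finset.sum_add_distrib]
    refine Finset.sum_congr rfl fun n _ => ?_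
    rw [← smul_add, ← midSeries_eq]
  have key : ∀ m, m < 2 * (N + 1) → coeff m A = coeff m A' ∧ coeff m B = coeff m B' := by
    intro m
    induction m using Nat.strong_induction_on with
    | _ m ih =>
    intro hm
    -- B comes before A: coefficient m of A involves coefficient m of B, whereas that of B involves
    -- only lower ones.
    have hb : coeff m B = coeff m B' := by
      rw [eB, eB']
      rcases m with _ | _ | m
      · simp
      · simp [coeff_succ_X_mul, coeff_lift, (ih 0 (by omega) (by omega)).2]
      · simp [coeff_succ_X_mul, coeff_lift, (ih m (by omega) (by omega)).1,
          (ih (m + 1) (by omega) (by omega)).2]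
    refine ⟨?_, hb⟩
    have h0 : coeff m (w ^ (2 * N + 2) • lift intA (lift intA (midSeries N))) = 0 := by
      rw [coeff_real_smul, coeff_lift, coeff_lift, midSeries, coeff_X_pow_mul', if_neg (by omega)]
      simp
    have h1 := congrArg (coeff m) eA'
    rw [map_add, h0, add_zero] at h1
    rw [h1, eA]
    cases m with
    | zero =>
      rw [coeff_zero_eq_constantCoeff] at hb
      simp [constantCoeff_lift, hb]
    | succ m =>
      simp [coeff_succ_X_mul, coeff_lift, hb, (ih m (by omega) (by omega)).1]
  rw [(key m hm).1, hA', map_sum]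
  rfl

/-! ### Nested sums as sums of polylogarithm coefficients -/

/-- The indices of the nested sum of depth `k` with all entries less than `N`. -/
def idxBelow (k N : ℕ) : Finset (Idx k) :=
  Finset.subtype _ (Fintype.piFinset fun _ : Fin k => Finset.range N)

theorem mem_idxBelow {k N : ℕ} {t : Idx k} : t ∈ idxBelow k N ↔ ∀ j, t.1 j < N := by
  simp [idxBelow]

/-- The index with leading entry `j` followed by `t`. -/
def Idx.cons {k : ℕ} (j : ℕ) (t : Idx k) (hj : 0 < j) (h : ∀ i, t.1 i < j) : Idx (k + 1) :=
  ⟨Fin.cons j t.1, by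
    refine ⟨fun a b hab => ?_, fun a => ?_⟩
    · induction b using Fin.cases with
      | zero => exact absurd hab (Fin.not_lt_zero a)
      | succ b =>
        induction a using Fin.cases with
        | zero => simpa using h b
        | succ a => simpa using t.2.1 (Fin.succ_lt_succ_iff.1 hab)
    · induction a using Fin.cases with
      | zero => simpa using hj
      | succ a => simpa using t.2.2 a⟩

/-- The index without its leading entry. -/
def Idx.tail {k : ℕ} (t : Idx (k + 1)) : Idx k :=
  ⟨Fin.tail t.1, fun _ _ hab => t.2.1 (Fin.succ_lt_succ_iff.2 hab), fun a => t.2.2 a.succ⟩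

/-- Positivity of N matters for the empty string: its single index lies in `idxBelow 0 0`, while the
right side would be empty. -/
theorem sum_idxBelow_term (s : List ℕ) {N : ℕ} (hN : 0 < N) :
    ∑ t ∈ idxBelow s.length N, term s t = ∑ j ∈ Finset.range N, coeff j (mpl s) := by
  induction s generalizing N with
  | nil =>
    have h : idxBelow 0 N = {⟨Fin.elim0, fun a => a.elim0, fun a => a.elim0⟩} := by
      ext t
      simp only [mem_idxBelow, Finset.mem_singleton]
      exact ⟨fun _ => Subtype.ext (funext fun a => a.elim0), fun _ a => a.elim0⟩
    change ∑ t ∈ idxBelow 0 N, term [] t = _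
    rw [h, Finset.sum_singleton]
    simp [term, mpl, coeff_one, hN]
  | cons k s ih =>
    have h : ∀ j ∈ Finset.range N, coeff j (mpl (k :: s)) =
        if 0 < j then ∑ t ∈ idxBelow s.length j, term s t / (j : ℝ) ^ k else 0 := by
      intro j _
      rw [coeff_mpl_cons]
      split_ifs with hj
      · rw [← ih hj, Finset.sum_div]
      · obtain rfl : j = 0 := by omega
        simp
    rw [Finset.sum_congr rfl h, ← Finset.sum_filter, Finset.sum_sigma']
    symm
    refine Finset.sum_bij' (fun y hy => Idx.cons y.1 y.2 ?_ ?_)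
      (fun t _ => ⟨t.1 0, Idx.tail t⟩) ?_ ?_ ?_ ?_ ?_
    · simp only [Finset.mem_sigma, Finset.mem_filter] at hy
      exact hy.1.2
    · simp only [Finset.mem_sigma, mem_idxBelow] at hy
      exact hy.2
    · rintro ⟨j, t⟩ hy
      simp only [Finset.mem_sigma, Finset.mem_filter, Finset.mem_range, mem_idxBelow] at hy
      refine mem_idxBelow.2 fun a => ?_
      induction a using Fin.cases with
      | zero => exact hy.1.1
      | succ a => exact (hy.2 a).trans hy.1.1
    · intro t ht
      have ht' := mem_idxBelow.1 ht
      simp only [Finset.mem_sigma, Finset.mem_filter, Finset.mem_range, mem_idxBelow]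
      exact ⟨⟨ht' 0, t.2.2 0⟩, fun i => t.2.1 (Fin.succ_pos i)⟩
    · rintro ⟨j, t⟩ _
      rfl
    · intro t _
      exact Subtype.ext (Fin.cons_self_tail t.1)
    · rintro ⟨j, t⟩ _
      change _ = ∏ i : Fin (s.length + 1), (((Fin.cons j t.1 : Fin (s.length + 1) → ℕ) i : ℝ) ^
        (k :: s).get i)⁻¹
      rw [Fin.prod_univ_succ]
      simp [term, div_eq_mul_inv, mul_comm]

theorem coeff_mpl_nonneg (s : List ℕ) (N : ℕ) : 0 ≤ coeff N (mpl s) := by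
  induction s generalizing N with
  | nil => rw [mpl, coeff_one]; split_ifs <;> norm_num
  | cons k s ih =>
    rw [coeff_mpl_cons]
    exact div_nonneg (Finset.sum_nonneg fun j _ => ih j) (by positivity)

/-- The terms are nonnegative and the sets `idxBelow` exhaust the index set, so the limit along them
is the full sum. -/
theorem hasSum_term {s : List ℕ} (h : Summable fun N => coeff N (mpl s)) :
    HasSum (term s) (∑' N, coeff N (mpl s)) := by
  have hmono : Monotone fun N => idxBelow s.length (N + 1) := fun a b hab t ht =>
    mem_idxBelow.2 fun j => (mem_idxBelow.1 ht j).trans_le (by omega)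
  have htop : Filter.Tendsto (fun N => idxBelow s.length (N + 1)) Filter.atTop Filter.atTop := by
    refine Filter.tendsto_atTop_finset_of_monotone hmono fun t => ⟨∑ j, t.1 j, ?_⟩
    exact mem_idxBelow.2 fun j => Nat.lt_succ_of_le
      (Finset.single_le_sum (f := t.1) (fun _ _ => Nat.zero_le _) (Finset.mem_univ j))
  have hnonneg : ∀ t, 0 ≤ term s t := fun t => Finset.prod_nonneg fun j _ => by positivity
  have hsum : Summable (term s) := by
    refine summable_of_sum_le (c := ∑' N, coeff N (mpl s)) hnonneg fun u => ?_
    obtain ⟨N, hN⟩ := (htop.eventually_ge_atTop u).exists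
    refine (Finset.sum_le_sum_of_subset_of_nonneg hN fun t _ _ => hnonneg t).trans ?_
    rw [sum_idxBelow_term s N.succ_pos]
    exact h.sum_le_tsum _ fun j _ => coeff_mpl_nonneg s j
  have h1 := hsum.hasSum.comp htop
  have h2 := h.hasSum.tendsto_sum_nat.comp (Filter.tendsto_add_atTop_nat 1)
  have h3 : (fun u => ∑ t ∈ u, term s t) ∘ (fun N => idxBelow s.length (N + 1)) =
      (fun N => ∑ j ∈ Finset.range N, coeff j (mpl s)) ∘ fun N => N + 1 :=
    funext fun N => sum_idxBelow_term s N.succ_pos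
  rw [h3] at h1
  rw [← tendsto_nhds_unique h1 h2]
  exact hsum.hasSum

/-! ### Convergence -/

theorem sum_sqrt_div_le (N : ℕ) :
    ∑ j ∈ Finset.range N, √(j : ℝ) / j ≤ 3 * √(N : ℝ) := by
  induction N with
  | zero => simp
  | succ N ih =>
    rw [Finset.sum_range_succ]
    rcases Nat.eq_zero_or_pos N with rfl | hN
    · simp
    have h1 : (1 : ℝ) ≤ N := by exact_mod_cast hN
    have ha : 0 < √(N : ℝ) := Real.sqrt_pos.2 (by linarith)
    have ha2 := Real.sq_sqrt (show (0 : ℝ) ≤ N by linarith)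
    have hb2 := Real.sq_sqrt (show (0 : ℝ) ≤ ((N + 1 : ℕ) : ℝ) by positivity)
    push_cast at hb2 ⊢
    have hb : √((N : ℝ) + 1) ≤ 2 * √(N : ℝ) :=
      Real.sqrt_le_iff.2 ⟨by positivity, by rw [mul_pow, ha2]; linarith⟩
    have hab : √(N : ℝ) ≤ √((N : ℝ) + 1) := Real.sqrt_le_sqrt (by linarith)
    have hdiv : √(N : ℝ) / N ≤ 3 * (√((N : ℝ) + 1) - √(N : ℝ)) := by
      rw [div_le_iff₀ (by linarith)]
      -- With a = √N and b = √(N+1) ≤ 2a, 1 = b² - a² = (b + a)(b - a) ≤ 3a(b - a); hence the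
      -- constant 3.
      have : 1 ≤ 3 * √(N : ℝ) * (√((N : ℝ) + 1) - √(N : ℝ)) := by
        nlinarith [mul_nonneg (sub_nonneg.2 hb) (sub_nonneg.2 hab)]
      nlinarith
    linarith

theorem coeff_mpl_cons_le {s : List ℕ} {C : ℝ}
    (hC : ∀ N, ∑ j ∈ Finset.range N, coeff j (mpl s) ≤ C * √(N : ℝ)) {d k : ℕ}
    (hk : d ≤ k) (N : ℕ) : coeff N (mpl (k :: s)) ≤ C * (√(N : ℝ) / (N : ℝ) ^ d) := by
  rw [coeff_mpl_cons]
  rcases Nat.eq_zero_or_pos N with rfl | hN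
  · simp
  have h1 : (1 : ℝ) ≤ N := by exact_mod_cast hN
  have h0 : 0 ≤ ∑ j ∈ Finset.range N, coeff j (mpl s) :=
    Finset.sum_nonneg fun j _ => coeff_mpl_nonneg s j
  rw [← mul_div_assoc]
  exact div_le_div₀ (h0.trans (hC N)) (hC N) (by positivity) (pow_le_pow_right₀ h1 hk)

/-- √N is a crude substitute for powers of log N that survives each further exponent ≥ 1. A leading
exponent ≥ 2 then leaves the summable N^(-3/2). -/
theorem exists_sum_coeff_mpl_le {s : List ℕ} (hs : ∀ k ∈ s, 1 ≤ k) :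
    ∃ C : ℝ, ∀ N, ∑ j ∈ Finset.range N, coeff j (mpl s) ≤ C * √(N : ℝ) := by
  induction s with
  | nil =>
    refine ⟨1, fun N => ?_⟩
    rcases Nat.eq_zero_or_pos N with rfl | hN
    · simp
    · simpa [mpl, coeff_one, hN] using Nat.one_le_iff_ne_zero.2 hN.ne'
  | cons k s ih =>
    obtain ⟨C, hC⟩ := ih fun k hk => hs k (List.mem_cons_of_mem _ hk)
    have hC0 : 0 ≤ C := by
      have := (Finset.sum_nonneg fun j _ => coeff_mpl_nonneg s j).trans (hC 1)
      simpa using this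
    refine ⟨C * 3, fun N => ?_⟩
    calc ∑ j ∈ Finset.range N, coeff j (mpl (k :: s))
        ≤ ∑ j ∈ Finset.range N, C * (√(j : ℝ) / (j : ℝ) ^ 1) :=
          Finset.sum_le_sum fun j _ => coeff_mpl_cons_le hC (hs k List.mem_cons_self) j
      _ = C * ∑ j ∈ Finset.range N, √(j : ℝ) / j := by simp only [pow_one, Finset.mul_sum]
      _ ≤ C * (3 * √(N : ℝ)) := mul_le_mul_of_nonneg_left (sum_sqrt_div_le N) hC0
      _ = C * 3 * √(N : ℝ) := by ring

theorem summable_coeff_mpl_nil : Summable fun N => coeff N (mpl []) :=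
  summable_of_ne_finset_zero (s := {0}) fun N hN => by
    simp only [Finset.mem_singleton] at hN
    simp [mpl, coeff_one, hN]

theorem summable_coeff_mpl_cons {k : ℕ} {s : List ℕ} (hk : 2 ≤ k) (hs : ∀ k ∈ s, 1 ≤ k) :
    Summable fun N => coeff N (mpl (k :: s)) := by
  obtain ⟨C, hC⟩ := exists_sum_coeff_mpl_le hs
  refine Summable.of_nonneg_of_le (coeff_mpl_nonneg _) (coeff_mpl_cons_le hC hk)
    (Summable.mul_left C ?_)
  refine (Real.summable_nat_rpow_inv (p := 3 / 2).2 (by norm_num)).congr fun N => ?_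
  rcases Nat.eq_zero_or_pos N with rfl | hN
  · simp
  have h0 : (0 : ℝ) < N := by exact_mod_cast hN
  rw [Real.sqrt_eq_rpow, ← Real.rpow_natCast, ← Real.rpow_sub h0, ← Real.rpow_neg h0.le]
  norm_num

theorem one_le_of_mem_args {n : ℕ} (s : Fin (2 * n + 1) → ℕ) : ∀ k ∈ args s, 1 ≤ k := by
  intro k hk
  simp only [args, List.mem_append, List.mem_replicate, List.mem_flatMap, List.mem_cons] at hk
  rcases hk with hk | ⟨_, _, rfl | hk | rfl | hk⟩ <;> omega

theorem summable_coeff_mpl_args {n : ℕ} (s : Fin (2 * n + 1) → ℕ) :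
    Summable fun N => coeff N (mpl (args s)) := by
  have h : args s = [] ∨ ∃ k t, args s = k :: t ∧ 2 ≤ k := by
    cases n with
    | zero => cases h : s 0 <;> simp [args, h, List.replicate_succ]
    | succ n =>
      rw [args_succ]
      cases h : s 0 <;> simp [List.replicate_succ]
  rcases h with h | ⟨k, t, h, hk⟩
  · rw [h]
    exact summable_coeff_mpl_nil
  · have := one_le_of_mem_args s
    rw [h] at this ⊢
    exact summable_coeff_mpl_cons hk fun k hk => this k (List.mem_cons_of_mem _ hk)

theorem summable_term_args {n : ℕ} (s : Fin (2 * n + 1) → ℕ) : Summable (term (args s)) :=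
  (hasSum_term (summable_coeff_mpl_args s)).summable

theorem hasSum_coeff_mpl_args {n : ℕ} (s : Fin (2 * n + 1) → ℕ) :
    HasSum (fun N => coeff N (mpl (args s))) (Z s) := by
  rw [Z, zeta, (hasSum_term (summable_coeff_mpl_args s)).tsum_eq]
  exact (summable_coeff_mpl_args s).hasSum

/-! ### Evaluation of ζ({2}^m) -/

theorem args_single (m : ℕ) : args (single m) = List.replicate m 2 := by
  simp [args, single]

/-- The truncation to `n₁ ≤ N` of `ζ({2}^m)`. -/
def truncTwo (m N : ℕ) : ℝ := ∑ j ∈ Finset.range (N + 1), coeff j (mpl (List.replicate m 2))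

theorem truncTwo_zero_left (N : ℕ) : truncTwo 0 N = 1 := by
  simp [truncTwo, mpl, coeff_one]

theorem truncTwo_zero_right (m : ℕ) : truncTwo (m + 1) 0 = 0 := by
  simp [truncTwo, mpl, List.replicate_succ]

theorem truncTwo_succ (m N : ℕ) :
    truncTwo (m + 1) (N + 1) = truncTwo (m + 1) N + truncTwo m N / ((N : ℝ) + 1) ^ 2 := by
  rw [truncTwo, Finset.sum_range_succ, ← truncTwo, List.replicate_succ, coeff_mpl_cons,
    ← truncTwo]
  push_cast
  rfl

theorem truncTwo_nonneg (m N : ℕ) : 0 ≤ truncTwo m N :=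
  Finset.sum_nonneg fun _ _ => coeff_mpl_nonneg _ _

/-- `truncTwo m N` is the m-th elementary symmetric function of 1/j², 1 ≤ j ≤ N. -/
theorem hasSum_truncTwo (y : ℝ) (N : ℕ) :
    HasSum (fun m => truncTwo m N * y ^ m)
      (∏ j ∈ Finset.range N, (1 + y / ((j : ℝ) + 1) ^ 2)) := by
  induction N with
  | zero =>
    have := hasSum_single (f := fun m => truncTwo m 0 * y ^ m) 0 fun m hm => by
      obtain ⟨m, rfl⟩ := Nat.exists_eq_succ_of_ne_zero hm
      simp [truncTwo_zero_right]
    simpa [truncTwo_zero_left] using this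
  | succ N ih =>
    rw [Finset.prod_range_succ]
    have h1 := (hasSum_nat_add_iff' 1).2 ih
    have h2 := h1.add (ih.mul_right (y / ((N : ℝ) + 1) ^ 2))
    rw [← hasSum_nat_add_iff' 1]
    convert h2 using 1
    · funext m
      rw [truncTwo_succ]
      ring
    · simp [truncTwo_zero_left]
      ring

/-- The bound is uniform in N, as dominated convergence requires. -/
theorem exists_truncTwo_le : ∃ K : ℝ, 0 < K ∧ ∀ m N, truncTwo m N ≤ K ^ m := by
  have hs : Summable fun j : ℕ => 1 / (j : ℝ) ^ 2 := Real.summable_one_div_nat_pow.2 one_lt_two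
  have hK : 0 ≤ ∑' j : ℕ, 1 / (j : ℝ) ^ 2 := tsum_nonneg fun j => by positivity
  refine ⟨1 + ∑' j : ℕ, 1 / (j : ℝ) ^ 2, by linarith, fun m => ?_⟩
  induction m with
  | zero => intro N; simp [truncTwo_zero_left]
  | succ m ih =>
    intro N
    set K := 1 + ∑' j : ℕ, 1 / (j : ℝ) ^ 2
    have h0 : 0 ≤ K ^ m := pow_nonneg (by linarith) m
    calc truncTwo (m + 1) N
        ≤ ∑ j ∈ Finset.range (N + 1), K ^ m * (1 / (j : ℝ) ^ 2) := by
          refine Finset.sum_le_sum fun j _ => ?_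
          rw [List.replicate_succ, coeff_mpl_cons, mul_one_div]
          refine div_le_div_of_nonneg_right ?_ (by positivity)
          cases j with
          | zero => simpa using h0
          | succ j => exact ih j
      _ = K ^ m * ∑ j ∈ Finset.range (N + 1), 1 / (j : ℝ) ^ 2 := (Finset.mul_sum _ _ _).symm
      _ ≤ K ^ m * K := by
          refine mul_le_mul_of_nonneg_left ?_ h0
          exact (hs.sum_le_tsum _ fun j _ => by positivity).trans (by linarith)
      _ = K ^ (m + 1) := (pow_succ _ _).symm

theorem tendsto_truncTwo (m : ℕ) :
    Filter.Tendsto (truncTwo m) Filter.atTop (nhds (Z (single m))) := by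
  have h := (hasSum_coeff_mpl_args (single m)).tendsto_sum_nat.comp
    (Filter.tendsto_add_atTop_nat 1)
  rw [args_single] at h
  exact h

/-- Isolated zeros of an analytic function. Vanishing is asked only for y > 0 because the
application has y = z². -/
theorem eq_zero_of_forall_hasSum_zero {d : ℕ → ℝ} {r : ℝ} (hr : 0 < r)
    (hs : ∀ y : ℝ, |y| < r → Summable fun m => d m * y ^ m)
    (h : ∀ y : ℝ, 0 < y → y < r → HasSum (fun m => d m * y ^ m) 0) : d = 0 := by
  have hp : HasFPowerSeriesAt (fun y => ∑' m, d m * y ^ m)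
      (FormalMultilinearSeries.ofScalars ℝ d) 0 := by
    rw [hasFPowerSeriesAt_iff]
    filter_upwards [Metric.ball_mem_nhds (0 : ℝ) hr] with y hy
    have hy' : |y| < r := by simpa using hy
    simpa [FormalMultilinearSeries.coeff_ofScalars, mul_comm] using (hs y hy').hasSum
  have hf : ∃ᶠ y in nhdsWithin (0 : ℝ) {0}ᶜ, ∑' m, d m * y ^ m = 0 := by
    have h1 : ∀ᶠ y in nhdsWithin (0 : ℝ) (Set.Ioi 0), ∑' m, d m * y ^ m = 0 := by
      filter_upwards [Ioo_mem_nhdsGT hr] with y hy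
      exact (h y hy.1 hy.2).tsum_eq
    exact h1.frequently.filter_mono (nhdsWithin_mono _ fun y hy => ne_of_gt hy)
  have h0 := hp.locally_zero_iff.1 (hp.analyticAt.frequently_zero_iff_eventually_zero.1 hf)
  funext m
  have := congrArg (fun p => FormalMultilinearSeries.coeff p m) h0
  rw [FormalMultilinearSeries.coeff_ofScalars] at this
  exact this

/-- N → ∞ in the finite products: Euler's sine product on one side, dominated convergence with ratio
K z² < 1 on the other. -/
theorem hasSum_Z_single {K : ℝ} (hK : 0 < K) (h : ∀ m N, truncTwo m N ≤ K ^ m) {z : ℝ}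
    (hz : 0 < z) (hzK : z ^ 2 < K⁻¹) :
    HasSum (fun m => Z (single m) * (-z ^ 2) ^ m) (Real.sin (Real.pi * z) / (Real.pi * z)) := by
  have hZ : ∀ m, Z (single m) ≤ K ^ m := fun m => le_of_tendsto' (tendsto_truncTwo m) (h m)
  have hZ0 : ∀ m, 0 ≤ Z (single m) := fun m => ge_of_tendsto' (tendsto_truncTwo m)
    (truncTwo_nonneg m)
  have hlt : K * z ^ 2 < 1 := by
    have := mul_lt_mul_of_pos_left hzK hK
    rwa [mul_inv_cancel₀ hK.ne'] at this
  have hg : Summable fun m : ℕ => (K * z ^ 2) ^ m :=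
    summable_geometric_of_lt_one (by positivity) hlt
  have hb : ∀ {x : ℝ} (m : ℕ), 0 ≤ x → x ≤ K ^ m → ‖x * (-z ^ 2) ^ m‖ ≤ (K * z ^ 2) ^ m := by
    intro x m hx hx'
    rw [norm_mul, norm_pow, norm_neg, norm_pow, Real.norm_of_nonneg hx, Real.norm_of_nonneg hz.le,
      mul_pow]
    exact mul_le_mul_of_nonneg_right hx' (by positivity)
  have hlim := tendsto_tsum_of_dominated_convergence (𝓕 := Filter.atTop)
    (f := fun N m => truncTwo m N * (-z ^ 2) ^ m) (g := fun m => Z (single m) * (-z ^ 2) ^ m) hg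
    (fun m => (tendsto_truncTwo m).mul_const _)
    (Filter.Eventually.of_forall fun N m => hb m (truncTwo_nonneg m N) (h m N))
  have hpz : Real.pi * z ≠ 0 := by positivity
  have hsin := (Real.tendsto_euler_sin_prod z).div_const (Real.pi * z)
  have e : (fun N => ∑' m, truncTwo m N * (-z ^ 2) ^ m) = fun N : ℕ =>
      Real.pi * z * (∏ j ∈ Finset.range N, (1 - z ^ 2 / ((j : ℝ) + 1) ^ 2)) / (Real.pi * z) := by
    funext N
    rw [(hasSum_truncTwo _ N).tsum_eq, mul_div_cancel_left₀ _ hpz]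
    simp only [neg_div, sub_eq_add_neg]
  rw [e] at hlim
  rw [tendsto_nhds_unique hsin hlim]
  exact (Summable.of_norm_bounded hg fun m => hb m (hZ0 m) (hZ m)).hasSum

theorem Z_single (m : ℕ) :
    Z (single m) = Real.pi ^ (2 * m) / ((2 * m + 1).factorial : ℝ) := by
  obtain ⟨K, hK, h⟩ := exists_truncTwo_le
  have hsinc : ∀ y : ℝ, 0 < y → HasSum
      (fun m : ℕ => Real.pi ^ (2 * m) / ((2 * m + 1).factorial : ℝ) * (-y ^ 2) ^ m)
      (Real.sin (Real.pi * y) / (Real.pi * y)) := by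
    intro y hy
    have hpy : Real.pi * y ≠ 0 := by positivity
    refine ((Real.hasSum_sin (Real.pi * y)).div_const (Real.pi * y)).congr_fun fun m => ?_
    rw [neg_pow, ← pow_mul, pow_succ (Real.pi * y), mul_pow]
    field_simp
  set d : ℕ → ℝ := fun m =>
    (-1) ^ m * (Z (single m) - Real.pi ^ (2 * m) / ((2 * m + 1).factorial : ℝ)) with hd
  have hmain : ∀ y : ℝ, 0 < y → y < K⁻¹ → HasSum (fun m => d m * y ^ m) 0 := by
    intro y hy hyK
    have hz : 0 < √y := Real.sqrt_pos.2 hy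
    have hz2 : √y ^ 2 = y := Real.sq_sqrt hy.le
    have := (hasSum_Z_single hK h hz (by rwa [hz2])).sub (hsinc _ hz)
    rw [sub_self] at this
    refine this.congr_fun fun m => ?_
    rw [hz2, neg_pow, hd]
    ring
  have hd0 : d = 0 := by
    refine eq_zero_of_forall_hasSum_zero (inv_pos.2 hK) (fun y hy => ?_) hmain
    rcases eq_or_ne y 0 with rfl | hy0
    · exact summable_of_ne_finset_zero (s := {0}) fun m hm => by
        simp only [Finset.mem_singleton] at hm
        simp [hm]
    · refine Summable.of_norm ?_
      have := (hmain |y| (abs_pos.2 hy0) hy).summable.norm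
      simpa [norm_mul, norm_pow] using this
  have := congrFun hd0 m
  simp only [hd, Pi.zero_apply, mul_eq_zero, pow_eq_zero_iff', neg_eq_zero, one_ne_zero,
    false_and, false_or] at this
  linarith

/-! ### Evaluation at x = 1 and comparison of coefficients -/

theorem hasSum_coeff_mul {f g : ℝ⟦X⟧} {a b : ℝ} (hf : HasSum (fun n => coeff n f) a)
    (hg : HasSum (fun n => coeff n g) b) : HasSum (fun n => coeff n (f * g)) (a * b) := by
  simp only [coeff_mul]
  rw [← hf.tsum_eq, ← hg.tsum_eq, tsum_mul_tsum_eq_tsum_sum_antidiagonal_of_summable_norm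
    hf.summable.norm hg.summable.norm]
  exact (summable_norm_sum_mul_antidiagonal_of_summable_norm
    hf.summable.norm hg.summable.norm).of_norm.hasSum

/-- The sum of `Z` over all ways of inserting twos into `{3, 1} ^ n` with total weight `2 m`. -/
def sumZ (m n : ℕ) : ℝ :=
  if 2 * n ≤ m then ∑ s ∈ compositions (2 * n + 1) (m - 2 * n), Z s else 0

/-- Summing the coefficients in x of the shuffle identity in two ways. -/
theorem sum_mul_Z_single {p q w : ℝ} (hpq : p ^ 2 + q ^ 2 = 1) (hw : w = 2 * p * q) (m : ℕ) :
    ∑ x ∈ Finset.HasAntidiagonal.antidiagonal m,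
      (p ^ 2) ^ x.1 * Z (single x.1) * ((q ^ 2) ^ x.2 * Z (single x.2)) =
      ∑ n ∈ Finset.range (m + 1), w ^ (2 * n) * sumZ m n := by
  have htwo : ∀ (p : ℝ) (i : ℕ), HasSum (fun N => coeff N (coeff i (twoSeries p)))
      ((p ^ 2) ^ i * Z (single i)) := by
    intro p i
    have := (hasSum_coeff_mpl_args (single i)).mul_left ((p ^ 2) ^ i)
    rw [args_single, mpl_replicate] at this
    simpa [twoSeries] using this
  have h1 : HasSum (fun N => coeff N (coeff m (twoSeries p * twoSeries q)))
      (∑ x ∈ Finset.HasAntidiagonal.antidiagonal m,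
        (p ^ 2) ^ x.1 * Z (single x.1) * ((q ^ 2) ^ x.2 * Z (single x.2))) := by
    rw [coeff_mul m (twoSeries p)]
    simp only [map_sum]
    exact hasSum_sum fun x _ => hasSum_coeff_mul (htwo p x.1) (htwo q x.2)
  have h2 : HasSum (fun N => coeff N (coeff m (twoSeries p * twoSeries q)))
      (∑ n ∈ Finset.range (m + 1), w ^ (2 * n) * sumZ m n) := by
    rw [coeff_twoSeries_mul_twoSeries hpq hw (show m < 2 * (m + 1) by omega)]
    simp only [map_sum, map_smul, smul_eq_mul]
    refine hasSum_sum fun n _ => HasSum.mul_left _ ?_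
    rw [argsSeries, coeff_X_pow_mul', sumZ]
    split_ifs
    · simp only [coeff_mk, argsSum, map_sum]
      exact hasSum_sum fun s _ => hasSum_coeff_mpl_args s
    · simp
  exact h1.unique h2

theorem sum_range_two_mul (f : ℕ → ℝ) (R : ℕ) :
    ∑ k ∈ Finset.range (2 * R), f k = ∑ i ∈ Finset.range R, (f (2 * i) + f (2 * i + 1)) := by
  induction R with
  | zero => simp
  | succ R ih =>
    rw [Nat.mul_succ, Finset.sum_range_succ, Finset.sum_range_succ, ih, Finset.sum_range_succ]
    ring

theorem add_pow_sub_sub_pow (x y : ℝ) {K R : ℕ} (h : K < 2 * R) :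
    (x + y) ^ K - (x - y) ^ K =
      2 * ∑ i ∈ Finset.range R, x ^ (K - (2 * i + 1)) * y ^ (2 * i + 1) * K.choose (2 * i + 1) := by
  have hsub : Finset.range (K + 1) ⊆ Finset.range (2 * R) := Finset.range_mono h
  have e : ∀ z : ℝ, (x + z) ^ K =
      ∑ k ∈ Finset.range (2 * R), x ^ (K - k) * z ^ k * K.choose k := by
    intro z
    rw [add_comm, add_pow]
    refine (Finset.sum_congr rfl fun k _ => ?_).trans
      (Finset.sum_subset hsub fun k _ hk => ?_)
    · ring
    · rw [Finset.mem_range, not_lt] at hk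
      rw [Nat.choose_eq_zero_of_lt (by omega)]
      simp
  rw [sub_eq_add_neg x y, e, e, ← Finset.sum_sub_distrib, sum_range_two_mul, Finset.mul_sum]
  refine Finset.sum_congr rfl fun i _ => ?_
  rw [Even.neg_pow (even_two_mul i), Odd.neg_pow ⟨i, rfl⟩]
  ring

theorem sum_mul_Z_single_eq {p q w : ℝ} (hpq : p ^ 2 + q ^ 2 = 1) (hw : w = 2 * p * q)
    (hw0 : w ≠ 0) (m : ℕ) :
    ∑ x ∈ Finset.HasAntidiagonal.antidiagonal m,
      (p ^ 2) ^ x.1 * Z (single x.1) * ((q ^ 2) ^ x.2 * Z (single x.2)) =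
      ∑ n ∈ Finset.range (m + 1), w ^ (2 * n) *
        (2 * (m + 1).choose (2 * n + 1) * Real.pi ^ (2 * m) / ((2 * m + 2).factorial : ℝ)) := by
  have hf : ((2 * m + 2).factorial : ℝ) ≠ 0 := by positivity
  have h1 := add_pow_sub_sub_pow q p (K := 2 * m + 2) (R := m + 2) (by omega)
  have h2 := add_pow_sub_sub_pow 1 w (K := m + 1) (R := m + 1) (by omega)
  have h3 : (q + p) ^ (2 * m + 2) - (q - p) ^ (2 * m + 2) =
      (1 + w) ^ (m + 1) - (1 - w) ^ (m + 1) := by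
    rw [show 2 * m + 2 = 2 * (m + 1) by ring, pow_mul, pow_mul]
    congr 2
    · linear_combination hpq - hw
    · linear_combination hpq + hw
  -- The bound `K < 2 * R` forced one index too many; its binomial coefficient vanishes.
  rw [Finset.sum_range_succ, Nat.choose_eq_zero_of_lt
    (by omega : 2 * m + 2 < 2 * (m + 1) + 1)] at h1
  have hL : w * ∑ x ∈ Finset.HasAntidiagonal.antidiagonal m,
      (p ^ 2) ^ x.1 * Z (single x.1) * ((q ^ 2) ^ x.2 * Z (single x.2)) =
      Real.pi ^ (2 * m) / ((2 * m + 2).factorial : ℝ) *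
        ((q + p) ^ (2 * m + 2) - (q - p) ^ (2 * m + 2)) := by
    rw [h1, Finset.Nat.sum_antidiagonal_eq_sum_range_succ_mk]
    simp only [Nat.cast_zero, mul_zero, add_zero, Finset.mul_sum]
    refine Finset.sum_congr rfl fun i hi => ?_
    obtain ⟨j, rfl⟩ := Nat.exists_eq_add_of_le (Nat.lt_succ_iff.1 (Finset.mem_range.1 hi))
    rw [Nat.add_sub_cancel_left, Z_single, Z_single,
      Nat.cast_choose ℝ (by omega : 2 * i + 1 ≤ 2 * (i + j) + 2),
      show 2 * (i + j) + 2 - (2 * i + 1) = 2 * j + 1 by omega, hw]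
    field_simp
    ring
  have hR : w * ∑ n ∈ Finset.range (m + 1), w ^ (2 * n) *
        (2 * (m + 1).choose (2 * n + 1) * Real.pi ^ (2 * m) / ((2 * m + 2).factorial : ℝ)) =
      Real.pi ^ (2 * m) / ((2 * m + 2).factorial : ℝ) *
        ((1 + w) ^ (m + 1) - (1 - w) ^ (m + 1)) := by
    rw [h2]
    simp only [Finset.mul_sum, one_pow]
    refine Finset.sum_congr rfl fun i _ => ?_
    ring
  exact mul_left_cancel₀ hw0 (by rw [hL, hR, h3])

theorem sumZ_eq (m n : ℕ) (hn : n ≤ m) :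
    sumZ m n =
      2 * (m + 1).choose (2 * n + 1) * Real.pi ^ (2 * m) / ((2 * m + 2).factorial : ℝ) := by
  set c : ℕ → ℝ := fun n =>
    2 * (m + 1).choose (2 * n + 1) * Real.pi ^ (2 * m) / ((2 * m + 2).factorial : ℝ)
  set P : Polynomial ℝ := ∑ n ∈ Finset.range (m + 1), Polynomial.monomial (2 * n) (sumZ m n - c n)
  have hP : P = 0 := by
    refine Polynomial.eq_of_infinite_eval_eq P 0 ((Set.Ioo_infinite zero_lt_one).mono ?_)
    intro w hw
    -- Every w in (0, 1) is sin 2θ, so p = sin θ and q = cos θ are admissible and P has infinitely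
    -- many roots.
    set θ := Real.arcsin w / 2
    have hpq : Real.sin θ ^ 2 + Real.cos θ ^ 2 = 1 := Real.sin_sq_add_cos_sq θ
    have hw' : w = 2 * Real.sin θ * Real.cos θ := by
      rw [← Real.sin_two_mul, mul_div_cancel₀ _ two_ne_zero,
        Real.sin_arcsin (by linarith [hw.1]) hw.2.le]
    have := (sum_mul_Z_single hpq hw' m).symm.trans (sum_mul_Z_single_eq hpq hw' hw.1.ne' m)
    simp only [Set.mem_ofPred_eq, P, Polynomial.eval_finsetSum, Polynomial.eval_monomial,
      Polynomial.eval_zero, sub_mul, Finset.sum_sub_distrib, sub_eq_zero]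
    simpa only [mul_comm, c] using this
  have h := congrArg (fun Q => Polynomial.coeff Q (2 * n)) hP
  simp only [P, Polynomial.finsetSum_coeff, Polynomial.coeff_monomial, Polynomial.coeff_zero] at h
  rw [Finset.sum_eq_single n (fun b _ hb => if_neg (by omega))
    (fun hb => absurd (Finset.mem_range.2 (by omega)) hb), if_pos rfl, sub_eq_zero] at h
  exact h

/-! ### Cyclic sums and the conclusion -/

theorem sum_compositions_cyclicSum (n k : ℕ) :
    ∑ s ∈ compositions (2 * n + 1) k, cyclicSum s =
      (2 * n + 1) * ∑ s ∈ compositions (2 * n + 1) k, Z s := by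
  simp only [cyclicSum]
  rw [Finset.sum_comm]
  have h : ∀ j : Fin (2 * n + 1), ∑ s ∈ compositions (2 * n + 1) k, Z (fun i => s (i + j)) =
      ∑ s ∈ compositions (2 * n + 1) k, Z s := by
    intro j
    refine Finset.sum_equiv ((Equiv.addRight j).symm.arrowCongr (Equiv.refl ℕ)) (fun s => ?_)
      (fun s _ => rfl)
    rw [mem_compositions, mem_compositions]
    have := Equiv.sum_comp (Equiv.addRight j) s
    rw [← this]
    rfl
  rw [Finset.sum_congr rfl fun j _ => h j]
  simp

end MZV

end

theorem mainTheorem2 (m n : ℕ) (hmn : 2 * n ≤ m) :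
    (∀ s ∈ MZV.compositions (2 * n + 1) (m - 2 * n), Summable (MZV.term (MZV.args s))) ∧
    Summable (MZV.term (MZV.args (MZV.single m))) ∧
    ∑ s ∈ MZV.compositions (2 * n + 1) (m - 2 * n), MZV.cyclicSum s =
      MZV.Z (MZV.single m) * ((MZV.compositions (2 * n + 1) (m - 2 * n)).card : ℝ) ∧
    MZV.Z (MZV.single m) * ((MZV.compositions (2 * n + 1) (m - 2 * n)).card : ℝ) =
      MZV.Z (MZV.single m) * (m.choose (2 * n) : ℝ) ∧
    MZV.Z (MZV.single m) * (m.choose (2 * n) : ℝ) =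
      Real.pi ^ (2 * m) / ((2 * m + 1).factorial : ℝ) * (m.choose (2 * n) : ℝ) := by
  have hcard : (MZV.compositions (2 * n + 1) (m - 2 * n)).card = m.choose (2 * n) := by
    rw [MZV.card_compositions, Nat.sub_add_cancel hmn]
  refine ⟨fun s _ => MZV.summable_term_args s, MZV.summable_term_args _, ?_, by rw [hcard],
    by rw [MZV.Z_single]⟩
  have h := MZV.sumZ_eq m n (by omega)
  rw [MZV.sumZ, if_pos hmn] at h
  -- Absorption identity: it turns the factor 2n + 1 from the rotations into m + 1, which cancels
  -- against (2m+2)! = 2(m+1)(2m+1)!.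
  have hchoose : ((m : ℝ) + 1) * m.choose (2 * n) = (m + 1).choose (2 * n + 1) * (2 * n + 1) := by
    exact_mod_cast Nat.add_one_mul_choose_eq m (2 * n)
  rw [MZV.sum_compositions_cyclicSum, h, hcard, MZV.Z_single,
    show 2 * m + 2 = 2 * m + 1 + 1 by ring, Nat.factorial_succ (2 * m + 1)]
  push_cast
  field_simp
  linear_combination -2 * hchoose
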